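/- Let $n\ge 1$, let $\mathbb B^n$ be the open unit ball of $\mathbb C^n$, and write $z\bar w=\sum_{j=1}^n z_j\overline{w_j}$, $|z|^2=z\bar z$. Let $dm$ and $d\sigma$ be the normalized Lebesgue measures on $\mathbb B^n$ and on the unit sphere $S$. For $\alpha>-1$ let $B_\alpha^1$ be the space of holomorphic functions $f$ on $\mathbb B^n$ with $\int_{\mathbb B^n}(1-|z|^2)^\alpha|f(z)|\,dm(z)<\infty$, and let $B_{-1}^1$ be the Hardy space $H^1$ of holomorphic functions $f$ on $\mathbb B^n$ with $\sup_{0<r<1}\int_{S}|f(r\zeta)|\,d\sigma(\zeta)<\infty$. A sequence $\{a_k\}_k$ in $\mathbb B^n$ is *separated* if there is $\delta>0$ such that $d(a_j,a_k)\ge\delta$ for all $j\ne k$, where $d(a,b)=|\varphi_a(b)|$ and $\varphi_a$ is the involutive automorphism of $\mathbb B^n$ exchanging $0$ and $a$. It is *$B_\alpha^1$-interpolating* if for every sequence $\{v_k\}_k\subset\mathbb C$ with $\sum_k(1-|a_k|^2)^{n+1+\alpha}|v_k|<\infty$ there is $f\in B_\alpha^1$ with $f(a_k)=v_k$ for all $k$.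 For $p,q>0$ put $$K(\{a_k\},p,q)=\sup_k\sum_{j:\,j\ne k}\frac{(1-|a_k|^2)^p(1-|a_j|^2)^q}{|1-\bar a_k a_j|^{p+q}}\in[0,\infty].$$ **Theorem 4.2.** Let $\alpha\ge-1$ and let $\{a_k\}_k$ be a separated sequence in $\mathbb B^n$. If there exists $m>0$ such that $$K(\{a_k\},m,n+1+\alpha)<1,$$ then $\{a_k\}_k$ is $B_\alpha^1$-interpolating. -/

import Mathlib

open MeasureTheory
open scoped ENNReal ComplexConjugate

namespace BallInterp

/-- The space `ℂⁿ` with the Euclidean norm `|z|`. -/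
abbrev Cn (n : ℕ) : Type := EuclideanSpace ℂ (Fin n)

/-- The open unit ball of `ℂⁿ`. -/
def unitBall (n : ℕ) : Set (Cn n) := {z | ‖z‖ < 1}

/-- The Hermitian product `z w̄ = ∑ⱼ zⱼ w̄ⱼ`, linear in `z`. -/
noncomputable def herm {n : ℕ} (z w : Cn n) : ℂ := ∑ j, z j * conj (w j)

/-- The involutive automorphism of the ball exchanging `0` and `a`,
`φ_a(z) = (a - P_a z - (1 - |a|²)^{1/2} (z - P_a z)) / (1 - z ā)`,
where `P_a` is the orthogonal projection onto the complex line `ℂ a` (so `P_0 = 0`). -/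
noncomputable def ballAut {n : ℕ} (a z : Cn n) : Cn n :=
  (1 - herm z a)⁻¹ •
    (a - (ℂ ∙ a).starProjection z
      - ((Real.sqrt (1 - ‖a‖ ^ 2) : ℝ) : ℂ) • (z - (ℂ ∙ a).starProjection z))

/-- The invariant distance `d(a, b) = |φ_a(b)|` on the ball. -/
noncomputable def invDist {n : ℕ} (a b : Cn n) : ℝ := ‖ballAut a b‖

/-- A sequence is separated if distinct indices have invariant distance at least some `δ > 0`. -/
def IsSeparated {n : ℕ} (a : ℕ → Cn n) : Prop :=
  ∃ δ : ℝ, 0 < δ ∧ ∀ j k : ℕ, j ≠ k → δ ≤ invDist (a j) (a k)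

/-- `K({a_k}, p, q) = sup_k ∑_{j ≠ k} (1-|a_k|²)^p (1-|a_j|²)^q / |1 - ā_k a_j|^{p+q}`,
with values in `[0, ∞]`. -/
noncomputable def K {n : ℕ} (a : ℕ → Cn n) (p q : ℝ) : ℝ≥0∞ :=
  ⨆ k : ℕ, ∑' j : {j : ℕ // j ≠ k},
    ENNReal.ofReal ((1 - ‖a k‖ ^ 2) ^ p * (1 - ‖a j‖ ^ 2) ^ q /
      ‖1 - herm (a j) (a k)‖ ^ (p + q))

/-- Lebesgue measure on the unit ball, normalized to total mass `1`. -/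
noncomputable def ballMeasure (n : ℕ) : Measure (Cn n) :=
  (volume (unitBall n))⁻¹ • volume.restrict (unitBall n)

/-- The surface measure on the unit sphere, normalized to total mass `1`. -/
noncomputable def sphereMeasure (n : ℕ) : Measure (Metric.sphere (0 : Cn n) 1) :=
  ((volume : Measure (Cn n)).toSphere Set.univ)⁻¹ • (volume : Measure (Cn n)).toSphere

/-- `∫ (1-|z|²)^{αp} |f(z)|^p dm(z)`, as an element of `[0, ∞]`. -/
noncomputable def weightedInt {n : ℕ} (p α : ℝ) (f : Cn n → ℂ) : ℝ≥0∞ :=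
  ∫⁻ z, ENNReal.ofReal ((1 - ‖z‖ ^ 2) ^ (α * p) * ‖f z‖ ^ p) ∂(ballMeasure n)

/-- `sup_{0<r<1} ∫ |f(rζ)|^p dσ(ζ)`, as an element of `[0, ∞]`. -/
noncomputable def hardySup {n : ℕ} (p : ℝ) (f : Cn n → ℂ) : ℝ≥0∞ :=
  ⨆ r ∈ Set.Ioo (0 : ℝ) 1,
    ∫⁻ ζ : Metric.sphere (0 : Cn n) 1,
      ENNReal.ofReal (‖f ((r : ℂ) • (ζ : Cn n))‖ ^ p) ∂(sphereMeasure n)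

/-- The space `B_α^p` (`0 < p < ∞`, `α ≥ -1/p`) of holomorphic functions on the ball: the weighted
Bergman space for `α > -1/p`, and the Hardy space `H^p` for `α = -1/p`.
Only the values of `f` on the ball matter. -/
def MemB {n : ℕ} (p α : ℝ) (f : Cn n → ℂ) : Prop :=
  DifferentiableOn ℂ f (unitBall n) ∧
    (α ≠ -(1 / p) → weightedInt p α f < ∞) ∧ (α = -(1 / p) → hardySup p f < ∞)

/-- The sequence space `ℓ_β^p({a_k})`: those `v` for which `((1-|a_k|²)^β v_k)_k` is in `ℓ^p`. -/
def MemSeq {n : ℕ} (p β : ℝ) (a : ℕ → Cn n) (v : ℕ → ℂ) : Prop :=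
  Memℓp (fun k => (((1 - ‖a k‖ ^ 2) ^ β : ℝ) : ℂ) * v k) (ENNReal.ofReal p)

/-- `{a_k}` is interpolating for `B_α^p`: every `v ∈ ℓ^p_{(n+1)/p+α}({a_k})` is the sequence of
values on `{a_k}` of some `f ∈ B_α^p`. -/
def IsInterpolating {n : ℕ} (p α : ℝ) (a : ℕ → Cn n) : Prop :=
  ∀ v : ℕ → ℂ, MemSeq p (((n : ℝ) + 1) / p + α) a v →
    ∃ f : Cn n → ℂ, MemB p α f ∧ ∀ k, f (a k) = v k

end BallInterp

namespace BallInterp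

/-! Put `q = n + 1 + α` and `d_k = 1 - |a_k|²`, and look for `f = ∑ u_j kern (q+m) (a_j)`. Each
kernel equals `1` at its own pole, so with `x_j = d_j^q u_j` and `w_k = d_k^q v_k` the interpolation
problem reads `x + A x = w` in `ℓ¹`, where `A` is off-diagonal. The `ℓ¹` norm of column `j` of `A`
is exactly the `j`-th sum in `K a m q`. Hence `‖A‖ < 1` and a Neumann series gives `x`
(`exists_hasSum_of_column_le`). Such an `f` lies in `B_α^1` because each kernel has norm `O(d_j^q)`.
This is a Forelli–Rudin estimate, on the ball for `α > -1` and on spheres for `α = -1`. Both follow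
by dyadic summation (`lintegral_rpow_neg_le`) from the measure of the sublevel sets of `|1 - z ā|`:
caps have measure `O(t^n)`, and integrating over radii adds the exponent `1 + α`. -/

/-! ### The Hermitian form. -/

theorem herm_eq_inner {n : ℕ} (z w : Cn n) : herm z w = inner ℂ w z := by
  simp [herm, PiLp.inner_apply]

theorem herm_self {n : ℕ} (z : Cn n) : herm z z = ((‖z‖ ^ 2 : ℝ) : ℂ) := by
  rw [herm_eq_inner, inner_self_eq_norm_sq_to_K]; norm_cast

theorem norm_herm_le {n : ℕ} (z w : Cn n) : ‖herm z w‖ ≤ ‖z‖ * ‖w‖ := by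
  rw [herm_eq_inner, mul_comm]; exact norm_inner_le_norm w z

theorem herm_real_smul_left {n : ℕ} (r : ℝ) (z w : Cn n) : herm (r • z) w = r * herm z w := by
  simp [herm, Finset.mul_sum, mul_assoc]

theorem herm_real_smul_right {n : ℕ} (r : ℝ) (z w : Cn n) : herm z (r • w) = r * herm z w := by
  simp [herm, Finset.mul_sum, mul_left_comm]

theorem continuous_herm_left {n : ℕ} (w : Cn n) : Continuous fun z : Cn n => herm z w := by
  simp only [herm]; fun_prop

/-- This version gives the lower bound in terms of the pole; the primed one is uniform in the pole.
-/
theorem one_sub_norm_le_norm_one_sub_herm {n : ℕ} {z w : Cn n} (hz : ‖z‖ ≤ 1) :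
    1 - ‖w‖ ≤ ‖1 - herm z w‖ := by
  have h1 := norm_herm_le z w
  have h2 := norm_sub_norm_le (1 : ℂ) (herm z w)
  rw [norm_one] at h2
  nlinarith [norm_nonneg w]

theorem one_sub_norm_le_norm_one_sub_herm' {n : ℕ} {z w : Cn n} (hw : ‖w‖ ≤ 1) :
    1 - ‖z‖ ≤ ‖1 - herm z w‖ := by
  have h1 := norm_herm_le z w
  have h2 := norm_sub_norm_le (1 : ℂ) (herm z w)
  rw [norm_one] at h2
  nlinarith [norm_nonneg z]

/-! ### Measure of nonisotropic tubes and caps. -/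

/-- The image of Lebesgue measure in the coordinates of `ℂⁿ` is a multiple of the product measure. -/
theorem exists_volume_ofLp_preimage (n : ℕ) :
    ∃ c : ℝ≥0∞, c ≠ ∞ ∧ ∀ s : Set (Fin n → ℂ), MeasurableSet s →
      volume ((WithLp.ofLp : Cn n → (Fin n → ℂ)) ⁻¹' s) = c * volume s := by
  let L : Cn n ≃L[ℝ] (Fin n → ℂ) := PiLp.continuousLinearEquiv 2 ℝ (fun _ : Fin n => ℂ)
  have : (Measure.map L (volume : Measure (Cn n))).IsAddHaarMeasure :=
    L.isAddHaarMeasure_map volume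
  refine ⟨Measure.addHaarScalarFactor (Measure.map L (volume : Measure (Cn n))) volume,
    ENNReal.coe_ne_top, fun s hs => ?_⟩
  have h := Measure.isAddLeftInvariant_eq_smul (Measure.map L (volume : Measure (Cn n))) volume
  have h2 := congrArg (fun μ => μ s) h
  simp only [Measure.smul_apply] at h2
  rw [Measure.map_apply L.continuous.measurable hs] at h2
  exact h2

/-- The part of the unit ball near a unit vector `e`, measured by `|1 - z ē|`, has volume `O(t^{n+1})`. -/
theorem exists_volume_tube_le (n : ℕ) (hn : 1 ≤ n) :
    ∃ C : ℝ≥0∞, C ≠ ∞ ∧ ∀ e : Cn n, ‖e‖ = 1 → ∀ t : ℝ, 0 < t →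
      volume {z : Cn n | ‖z‖ < 1 ∧ ‖1 - herm z e‖ < t} ≤ C * ENNReal.ofReal (t ^ (n + 1)) := by
  obtain ⟨c, hc, hvol⟩ := exists_volume_ofLp_preimage n
  obtain ⟨k, rfl⟩ : ∃ k, n = k + 1 := ⟨n - 1, by omega⟩
  -- One disc of radius `t` and `k = n - 1` discs of radius `√(2t)`, in unitary coordinates whose
  -- first vector is `e`.
  refine ⟨c * (NNReal.pi * (2 * NNReal.pi) ^ k), by finiteness, fun e he t ht => ?_⟩
  obtain ⟨b, hb⟩ := Orthonormal.exists_orthonormalBasis_extension_of_card_eq (𝕜 := ℂ)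
    (E := Cn (k + 1)) (ι := Fin (k + 1)) (by simp) (v := fun _ => e) (s := {0}) (by
      rw [orthonormal_iff_ite]
      rintro ⟨i, rfl⟩ ⟨j, rfl⟩
      simp [inner_self_eq_norm_sq_to_K, he])
  have hb0 : b 0 = e := hb 0 rfl
  let U : Cn (k + 1) ≃ₗᵢ[ℝ] Cn (k + 1) :=
    { b.repr.toLinearEquiv.restrictScalars ℝ with norm_map' := b.repr.norm_map }
  have hU : MeasurePreserving U volume volume := U.measurePreserving
  have hUe (z) : (U z) 0 = herm z e := by
    rw [herm_eq_inner, ← hb0]; exact b.repr_apply_apply z 0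
  let rad : Fin (k + 1) → ℝ := Fin.cons t fun _ => √(2 * t)
  let ctr : Fin (k + 1) → ℂ := Fin.cons 1 fun _ => 0
  let box : Set (Fin (k + 1) → ℂ) := Set.univ.pi fun i => Metric.ball (ctr i) (rad i)
  have hbox : MeasurableSet box := MeasurableSet.univ_pi fun i => measurableSet_ball
  have hsub : {z : Cn (k + 1) | ‖z‖ < 1 ∧ ‖1 - herm z e‖ < t} ⊆
      U ⁻¹' (WithLp.ofLp ⁻¹' box) := by
    rintro z ⟨hz, hzt⟩ i -
    have hn : ‖U z‖ ^ 2 < 1 := by rw [U.norm_map]; nlinarith [norm_nonneg z]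
    rw [EuclideanSpace.norm_sq_eq, Fin.sum_univ_succ] at hn
    rw [← hUe, norm_sub_rev] at hzt
    refine Fin.cases ?_ (fun j => ?_) i
    · simpa [ctr, rad, dist_eq_norm] using hzt
    · have h1 : ‖U z j.succ‖ ^ 2 ≤ ∑ j : Fin k, ‖U z j.succ‖ ^ 2 :=
        Finset.single_le_sum (f := fun j : Fin k => ‖U z j.succ‖ ^ 2)
          (fun _ _ => sq_nonneg _) (Finset.mem_univ j)
      have h2 : 1 - ‖U z 0‖ < t := by
        have := norm_sub_norm_le (1 : ℂ) (U z 0)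
        rw [norm_one, norm_sub_rev] at this
        linarith
      -- The squared modulus is below `1 - |w|² ≤ 2(1 - |w|) < 2t`, with `w` the first coordinate.
      have h3 : ‖U z j.succ‖ < √(2 * t) := Real.lt_sqrt_of_sq_lt (by nlinarith [norm_nonneg (U z 0)])
      simpa [ctr, rad] using h3
  calc volume {z : Cn (k + 1) | ‖z‖ < 1 ∧ ‖1 - herm z e‖ < t}
      ≤ volume (U ⁻¹' (WithLp.ofLp ⁻¹' box)) := measure_mono hsub
    _ = volume ((WithLp.ofLp : Cn (k + 1) → _) ⁻¹' box) :=
        hU.measure_preimage ((WithLp.measurable_ofLp 2 _) hbox).nullMeasurableSet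
    _ = c * volume box := hvol _ hbox
    _ = c * (NNReal.pi * (2 * NNReal.pi) ^ k) * ENNReal.ofReal (t ^ (k + 1 + 1)) := by
        have h2 : ENNReal.ofReal √(2 * t) ^ 2 = 2 * ENNReal.ofReal t := by
          rw [← ENNReal.ofReal_pow (Real.sqrt_nonneg _), Real.sq_sqrt (by positivity),
            ENNReal.ofReal_mul zero_le_two, ENNReal.ofReal_ofNat]
        rw [volume_pi_pi, Fin.prod_univ_succ]
        simp only [ctr, rad, Fin.cons_zero, Fin.cons_succ, Complex.volume_ball, h2,
          Finset.prod_const, Finset.card_univ, Fintype.card_fin]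
        rw [ENNReal.ofReal_pow ht.le]
        ring

open scoped Pointwise in
/-- The nonisotropic caps of the sphere have surface measure `O(t^n)`. -/
theorem exists_toSphere_cap_le (n : ℕ) (hn : 1 ≤ n) :
    ∃ C : ℝ≥0∞, C ≠ ∞ ∧ ∀ a : Cn n, ‖a‖ < 1 → ∀ t : ℝ, 0 < t →
      (volume : Measure (Cn n)).toSphere {ζ | ‖1 - herm (ζ : Cn n) a‖ < t} ≤
        C * ENNReal.ofReal (t ^ n) := by
  obtain ⟨C, hC, htube⟩ := exists_volume_tube_le n hn
  have hfr : Module.finrank ℝ (Cn n) = 2 * n := by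
    rw [← Module.finrank_mul_finrank ℝ ℂ (Cn n)]; simp
  set S := (volume : Measure (Cn n)).toSphere with hS
  -- The first summand serves `t ≥ 1`, the second `t < 1`.
  refine ⟨S Set.univ + (2 * n : ℕ) * (C * ENNReal.ofReal (3 ^ (n + 1))), by finiteness,
    fun a ha t ht => ?_⟩
  rcases le_or_gt 1 t with h1 | h1
  · have h2 : (1 : ℝ≥0∞) ≤ ENNReal.ofReal (t ^ n) := by
      rw [ENNReal.one_le_ofReal]; exact one_le_pow₀ h1
    calc S {ζ | ‖1 - herm (ζ : Cn n) a‖ < t} ≤ S Set.univ * 1 := by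
          rw [mul_one]; exact measure_mono (Set.subset_univ _)
      _ ≤ _ := by gcongr; exact le_self_add
  obtain ⟨e, he, hae⟩ : ∃ e : Cn n, ‖e‖ = 1 ∧ a = ‖a‖ • e := by
    rcases eq_or_ne a 0 with rfl | h0
    · exact ⟨EuclideanSpace.single ⟨0, hn⟩ 1, by simp, by simp⟩
    · refine ⟨‖a‖⁻¹ • a, ?_, ?_⟩
      · rw [norm_smul]; simp [h0]
      · rw [smul_smul, mul_inv_cancel₀ (norm_ne_zero_iff.2 h0), one_smul]
  set Q : Set (Metric.sphere (0 : Cn n) 1) := {ζ | ‖1 - herm (ζ : Cn n) a‖ < t}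
  have hQ : MeasurableSet Q := by
    apply measurableSet_lt _ measurable_const
    exact ((continuous_const.sub ((continuous_herm_left a).comp continuous_subtype_val)).norm).measurable
  set V : Set (Cn n) := Set.Ioo (0 : ℝ) 1 • ((↑) '' Q)
  have hVB : V ⊆ Metric.ball 0 1 := by
    rintro _ ⟨r, hr, _, ⟨ζ, -, rfl⟩, rfl⟩
    simp only [mem_ball_zero_iff, norm_smul, Real.norm_eq_abs, abs_of_pos hr.1,
      norm_eq_of_mem_sphere, mul_one]
    exact hr.2
  have hVfin : volume V ≠ ∞ := (measure_mono hVB).trans_lt measure_ball_lt_top |>.ne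
  -- The cone over the cap is compared with its own dilate: what the dilate misses has radius at
  -- least `1 - t` and lies in a tube around `e`. This gives `|V| ≤ (1 - t)|V| + O(t^{n+1})`; since
  -- `|V|` is finite, absorbing and dividing by `t` leaves `O(t^n)`.
  have hcov : V ⊆ (1 - t) • V ∪ {z : Cn n | ‖z‖ < 1 ∧ ‖1 - herm z e‖ < 3 * t} := by
    intro z hz
    have hz1 : ‖z‖ < 1 := by simpa using hVB hz
    obtain ⟨r, hr, _, ⟨ζ, hζ, rfl⟩, rfl⟩ := hz
    rcases lt_or_ge r (1 - t) with h | h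
    · left
      refine ⟨(r / (1 - t)) • (ζ : Cn n), ⟨r / (1 - t), ⟨?_, ?_⟩, ζ, ⟨ζ, hζ, rfl⟩, rfl⟩, ?_⟩
      · exact div_pos hr.1 (by linarith)
      · rw [div_lt_one (by linarith)]; exact h
      · simp only [smul_smul]; rw [mul_div_cancel₀ _ (by linarith : (1 - t) ≠ 0)]
    · right
      refine ⟨hz1, ?_⟩
      have hζ' : ‖1 - herm (ζ : Cn n) a‖ < t := hζ
      have hζ1 : ‖(ζ : Cn n)‖ = 1 := norm_eq_of_mem_sphere ζ
      have hw := norm_herm_le (ζ : Cn n) e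
      rw [hζ1, he, mul_one] at hw
      have h3 := one_sub_norm_le_norm_one_sub_herm (z := (ζ : Cn n)) (w := a) hζ1.le
      have hha : herm (ζ : Cn n) a = ‖a‖ * herm (ζ : Cn n) e := by
        conv_lhs => rw [hae, herm_real_smul_right]
      rw [hha] at hζ' h3
      show ‖1 - herm (r • (ζ : Cn n)) e‖ < _
      rw [herm_real_smul_left]
      set w := herm (ζ : Cn n) e
      have e1 : 1 - (r : ℂ) * w = (1 - ‖a‖ * w) + ((‖a‖ - r : ℝ) : ℂ) * w := by push_cast; ring
      rw [e1]
      refine (norm_add_le _ _).trans_lt ?_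
      rw [norm_mul, Complex.norm_real, Real.norm_eq_abs]
      -- Both `‖a‖` and `r` lie within `t` of `1`: a nonempty cap forces `1 - ‖a‖ < t`.
      have h4 : |‖a‖ - r| ≤ t := by rw [abs_le]; constructor <;> linarith [hr.2]
      nlinarith [norm_nonneg w, abs_nonneg (‖a‖ - r)]
  have hmeas : volume V ≤ ENNReal.ofReal (1 - t) * volume V +
      C * ENNReal.ofReal ((3 * t) ^ (n + 1)) := by
    calc volume V ≤ volume ((1 - t) • V) + _ := (measure_mono hcov).trans (measure_union_le _ _)
      _ ≤ _ := by
        gcongr ?_ + ?_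
        · rw [Measure.addHaar_smul_of_nonneg _ (by linarith), hfr]
          gcongr
          exact pow_le_of_le_one (by linarith) (by linarith) (by omega)
        · exact htube e he _ (by positivity)
  have hfinal : volume V ≤ C * ENNReal.ofReal (3 ^ (n + 1)) * ENNReal.ofReal (t ^ n) := by
    lift C to NNReal using hC
    rw [← ENNReal.toReal_le_toReal hVfin (by finiteness)]
    rw [← ENNReal.toReal_le_toReal hVfin (by finiteness), ENNReal.toReal_add (by finiteness)
      (by finiteness)] at hmeas
    simp only [ENNReal.toReal_mul] at hmeas ⊢
    rw [ENNReal.toReal_ofReal (by linarith), ENNReal.toReal_ofReal (by positivity)] at hmeas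
    rw [ENNReal.toReal_ofReal (by positivity), ENNReal.toReal_ofReal (by positivity)]
    refine le_of_mul_le_mul_left ?_ ht
    rw [mul_pow, pow_succ t] at hmeas
    nlinarith
  calc S Q = (2 * n : ℕ) * volume V := by
        rw [hS, Measure.toSphere_apply' _ hQ, hfr]
    _ ≤ (2 * n : ℕ) * (C * ENNReal.ofReal (3 ^ (n + 1)) * ENNReal.ofReal (t ^ n)) := by gcongr
    _ = (2 * n : ℕ) * (C * ENNReal.ofReal (3 ^ (n + 1))) * ENNReal.ofReal (t ^ n) := by ring
    _ ≤ _ := by gcongr; exact le_add_self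

/-! ### Forelli–Rudin estimates. -/

/-- If the sublevel sets of `g ≥ s` have measure `O(t^q)`, then `∫ g^{-(q+m)} = O(s^{-m})`. -/
theorem lintegral_rpow_neg_le {X : Type*} [MeasurableSpace X] {q m : ℝ} (hq : 0 ≤ q) (hm : 0 < m)
    (μ : Measure X) (A : ℝ≥0∞) {g : X → ℝ} (hg : Measurable g) {s : ℝ} (hs : 0 < s)
    (hgs : ∀ᵐ x ∂μ, s ≤ g x)
    (hA : ∀ t : ℝ, 0 < t → μ {x | g x < t} ≤ A * ENNReal.ofReal (t ^ q)) :
    ∫⁻ x, ENNReal.ofReal (g x ^ (-(q + m))) ∂μ ≤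
      ENNReal.ofReal (2 ^ q * (1 - 2 ^ (-m))⁻¹) * A * ENNReal.ofReal (s ^ (-m)) := by
  have hlt (t : ℝ) : MeasurableSet {x | g x < t} := measurableSet_lt hg measurable_const
  have hpt : ∀ᵐ x ∂μ, ENNReal.ofReal (g x ^ (-(q + m))) ≤
      ∑' k : ℕ, {x | g x < 2 ^ (k + 1) * s}.indicator
        (fun _ => ENNReal.ofReal ((2 ^ k * s) ^ (-(q + m)))) x := by
    filter_upwards [hgs] with x hx
    -- Dyadic shell `2^k s ≤ g x < 2^(k+1) s`; the shells contribute a geometric series of ratio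
    -- `2^(-m)`.
    obtain ⟨k, hk1, hk2⟩ := exists_nat_pow_near (x := g x / s) (y := (2 : ℝ))
      ((one_le_div hs).2 hx) one_lt_two
    rw [le_div_iff₀ hs] at hk1
    rw [div_lt_iff₀ hs] at hk2
    refine le_trans ?_ (ENNReal.le_tsum k)
    rw [Set.indicator_of_mem (by exact hk2)]
    exact ENNReal.ofReal_le_ofReal
      (Real.rpow_le_rpow_of_nonpos (by positivity) hk1 (by linarith))
  have hr0 : (0 : ℝ) ≤ 2 ^ (-m) := by positivity
  have hr1 : (2 : ℝ) ^ (-m) < 1 := Real.rpow_lt_one_of_one_lt_of_neg one_lt_two (by linarith)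
  have hterm (k : ℕ) : ((2 ^ k * s) ^ (-(q + m)) * (2 ^ (k + 1) * s) ^ q : ℝ) =
      2 ^ q * s ^ (-m) * (2 ^ (-m)) ^ k := by
    have h2 : (0 : ℝ) < 2 ^ k := by positivity
    rw [show (2 : ℝ) ^ (k + 1) * s = 2 * (2 ^ k * s) by ring,
      Real.mul_rpow zero_le_two (by positivity), mul_left_comm, ← Real.rpow_add (by positivity),
      show -(q + m) + q = -m by ring, Real.mul_rpow (by positivity) hs.le, ← Real.rpow_natCast,
      ← Real.rpow_natCast, ← Real.rpow_mul zero_le_two, ← Real.rpow_mul zero_le_two,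
      mul_comm (k : ℝ)]
    ring
  calc ∫⁻ x, ENNReal.ofReal (g x ^ (-(q + m))) ∂μ
      ≤ ∫⁻ x, ∑' k : ℕ, {x | g x < 2 ^ (k + 1) * s}.indicator
        (fun _ => ENNReal.ofReal ((2 ^ k * s) ^ (-(q + m)))) x ∂μ := lintegral_mono_ae hpt
    _ = ∑' k : ℕ, ENNReal.ofReal ((2 ^ k * s) ^ (-(q + m))) * μ {x | g x < 2 ^ (k + 1) * s} := by
        rw [lintegral_tsum fun k => (measurable_const.indicator (hlt _)).aemeasurable]
        simp only [lintegral_indicator_const (hlt _)]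
    _ ≤ ∑' k : ℕ, ENNReal.ofReal ((2 ^ k * s) ^ (-(q + m))) *
          (A * ENNReal.ofReal ((2 ^ (k + 1) * s) ^ q)) := by
        gcongr with k
        exact hA _ (by positivity)
    _ = ∑' k : ℕ, A * ENNReal.ofReal (2 ^ q * s ^ (-m) * (2 ^ (-m)) ^ k) := by
        congr 1 with k
        rw [← hterm, ENNReal.ofReal_mul (by positivity)]
        ring
    _ = _ := by
        rw [ENNReal.tsum_mul_left, ← ENNReal.ofReal_tsum_of_nonneg (fun k => by positivity)
          ((summable_geometric_of_lt_one hr0 hr1).mul_left _), tsum_mul_left,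
          tsum_geometric_of_lt_one hr0 hr1, mul_right_comm, ENNReal.ofReal_mul
          (mul_nonneg (by positivity) (inv_nonneg.2 (by linarith)))]
        ring

/-- Integration in polar coordinates. -/
theorem lintegral_eq_polar {n : ℕ} (hn : 1 ≤ n) {f : Cn n → ℝ≥0∞} (hf : Measurable f) :
    ∫⁻ z, f z = ∫⁻ r in Set.Ioi (0 : ℝ), ENNReal.ofReal (r ^ (2 * n - 1)) *
      ∫⁻ ζ : Metric.sphere (0 : Cn n) 1, f (r • (ζ : Cn n)) ∂(volume : Measure (Cn n)).toSphere := by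
  have hfr : Module.finrank ℝ (Cn n) = 2 * n := by
    rw [← Module.finrank_mul_finrank ℝ ℂ (Cn n)]; simp
  have : Nontrivial (Cn n) := Module.nontrivial_of_finrank_pos (R := ℝ) (by omega)
  have hmp := (volume : Measure (Cn n)).measurePreserving_homeomorphUnitSphereProd
  have hsm : Continuous fun p : Metric.sphere (0 : Cn n) 1 × Set.Ioi (0 : ℝ) =>
      (p.2 : ℝ) • (p.1 : Cn n) := by fun_prop
  have hF : Measurable fun p : Metric.sphere (0 : Cn n) 1 × Set.Ioi (0 : ℝ) =>
      f ((p.2 : ℝ) • (p.1 : Cn n)) := hf.comp hsm.measurable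
  calc ∫⁻ z, f z = ∫⁻ z in {0}ᶜ, f z := by rw [restrict_compl_singleton]
    _ = ∫⁻ z : ({0}ᶜ : Set (Cn n)), f z ∂((volume : Measure (Cn n)).comap Subtype.val) := by
      rw [lintegral_subtype_comap (measurableSet_singleton _).compl]
    _ = ∫⁻ p, f ((p.2 : ℝ) • (p.1 : Cn n)) ∂((volume : Measure (Cn n)).toSphere.prod
          (Measure.volumeIoiPow (Module.finrank ℝ (Cn n) - 1))) := by
      rw [← hmp.lintegral_comp hF]
      congr 1 with z
      congr 1
      have hz : ‖(z : Cn n)‖ ≠ 0 := norm_ne_zero_iff.2 z.2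
      simp [smul_smul, mul_inv_cancel₀ hz]
    _ = ∫⁻ r : Set.Ioi (0 : ℝ), ∫⁻ ζ : Metric.sphere (0 : Cn n) 1, f ((r : ℝ) • (ζ : Cn n))
          ∂(volume : Measure (Cn n)).toSphere ∂(Measure.volumeIoiPow (2 * n - 1)) := by
      rw [hfr, lintegral_prod_symm _ hF.aemeasurable]
    _ = _ := by
      rw [Measure.volumeIoiPow, lintegral_withDensity_eq_lintegral_mul _ (by fun_prop)
        hF.lintegral_prod_left']
      exact lintegral_subtype_comap measurableSet_Ioi fun r : ℝ => ENNReal.ofReal (r ^ (2 * n - 1)) *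
        ∫⁻ ζ : Metric.sphere (0 : Cn n) 1, f (r • (ζ : Cn n)) ∂(volume : Measure (Cn n)).toSphere

theorem half_one_sub_sq_le {n : ℕ} {a : Cn n} : (1 - ‖a‖ ^ 2) / 2 ≤ 1 - ‖a‖ := by
  nlinarith [sq_nonneg (1 - ‖a‖)]

theorem half_one_sub_sq_pos {n : ℕ} {a : Cn n} (ha : ‖a‖ < 1) : 0 < (1 - ‖a‖ ^ 2) / 2 := by
  nlinarith [norm_nonneg a]

theorem ofReal_half_rpow_neg {x m : ℝ} (hx : 0 ≤ x) :
    ENNReal.ofReal ((x / 2) ^ (-m)) = ENNReal.ofReal (2 ^ m) * ENNReal.ofReal (x ^ (-m)) := by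
  rw [Real.div_rpow hx zero_le_two, Real.rpow_neg zero_le_two, div_inv_eq_mul,
    ENNReal.ofReal_mul (by positivity), mul_comm]

/-- The Forelli–Rudin estimate on spheres. -/
theorem exists_lintegral_sphere_le (n : ℕ) (hn : 1 ≤ n) {m : ℝ} (hm : 0 < m) :
    ∃ C : ℝ≥0∞, C ≠ ∞ ∧ ∀ a : Cn n, ‖a‖ < 1 → ∀ r ∈ Set.Ioo (0 : ℝ) 1,
      ∫⁻ ζ : Metric.sphere (0 : Cn n) 1,
        ENNReal.ofReal (‖1 - herm ((r : ℂ) • (ζ : Cn n)) a‖ ^ (-((n : ℝ) + m))) ∂(sphereMeasure n) ≤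
      C * ENNReal.ofReal ((1 - ‖a‖ ^ 2) ^ (-m)) := by
  obtain ⟨C, hC, hcap⟩ := exists_toSphere_cap_le n hn
  have : Nonempty (Fin n) := ⟨⟨0, hn⟩⟩
  have hS : (volume : Measure (Cn n)).toSphere Set.univ ≠ 0 := by
    rw [Ne, Measure.measure_univ_eq_zero]; exact Measure.toSphere_ne_zero _
  refine ⟨((volume : Measure (Cn n)).toSphere Set.univ)⁻¹ *
    (ENNReal.ofReal (2 ^ (n : ℝ) * (1 - 2 ^ (-m))⁻¹) * C * ENNReal.ofReal (2 ^ m)),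
    ENNReal.mul_ne_top (ENNReal.inv_ne_top.2 hS) (by finiteness), fun a ha r hr => ?_⟩
  have hra : ‖r • a‖ ≤ ‖a‖ := by
    rw [norm_smul, Real.norm_eq_abs, abs_of_pos hr.1]; nlinarith [hr.2, norm_nonneg a]
  -- Moving `r` onto the pole makes the cap estimate apply uniformly in `r`.
  have hherm (ζ : Cn n) : herm ((r : ℂ) • ζ) a = herm ζ (r • a) := by
    rw [herm_real_smul_right, ← herm_real_smul_left]; rfl
  simp only [hherm]
  have hp := half_one_sub_sq_pos ha
  have key := lintegral_rpow_neg_le (q := n) (m := m) (by positivity) hm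
    ((volume : Measure (Cn n)).toSphere) C
    (g := fun ζ : Metric.sphere (0 : Cn n) 1 => ‖1 - herm (ζ : Cn n) (r • a)‖)
    ((continuous_const.sub ((continuous_herm_left _).comp continuous_subtype_val)).norm).measurable
    hp (.of_forall fun ζ => by
      have := one_sub_norm_le_norm_one_sub_herm (w := r • a) (norm_eq_of_mem_sphere ζ).le
      linarith [half_one_sub_sq_le (a := a)])
    (fun t ht => by
      simp only [Real.rpow_natCast]
      exact hcap _ (hra.trans_lt ha) t ht)
  rw [sphereMeasure, lintegral_smul_measure, smul_eq_mul, mul_assoc]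
  gcongr
  refine key.trans (le_of_eq ?_)
  rw [ofReal_half_rpow_neg (by linarith)]
  ring

/-- The radial mass of a boundary shell, finite because `α > -1`. -/
theorem lintegral_one_sub_rpow {α t : ℝ} (hα : -1 < α) (ht : 0 < t) :
    ∫⁻ r in Set.Ioo (1 - t) 1, ENNReal.ofReal ((1 - r) ^ α) =
      ENNReal.ofReal (t ^ (α + 1) / (α + 1)) := by
  have h1 : IntervalIntegrable (fun x : ℝ => x ^ α) volume 0 t :=
    intervalIntegral.intervalIntegrable_rpow' hα
  have h2 := (h1.comp_sub_left 1).symm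
  simp only [sub_zero] at h2
  rw [Measure.restrict_congr_set Ioo_ae_eq_Ioc, ← ofReal_integral_eq_lintegral_ofReal h2.1,
    ← intervalIntegral.integral_of_le (by linarith), intervalIntegral.integral_comp_sub_left
      (fun x : ℝ => x ^ α) 1, sub_self, sub_sub_cancel, integral_rpow (.inl hα),
    Real.zero_rpow (by linarith), sub_zero]
  filter_upwards [ae_restrict_mem measurableSet_Ioc] with r hr
  exact Real.rpow_nonneg (by linarith [hr.2]) _

/-- Nonisotropic balls have weighted volume `O(t^{n+1+α})`. -/
theorem exists_weighted_volume_le (n : ℕ) (hn : 1 ≤ n) {α : ℝ} (hα : -1 < α) :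
    ∃ C : ℝ≥0∞, C ≠ ∞ ∧ ∀ a : Cn n, ‖a‖ < 1 → ∀ t : ℝ, 0 < t →
      ((volume.restrict (unitBall n)).withDensity fun z => ENNReal.ofReal ((1 - ‖z‖ ^ 2) ^ α))
        {z | ‖1 - herm z a‖ < t} ≤ C * ENNReal.ofReal (t ^ ((n : ℝ) + 1 + α)) := by
  obtain ⟨C, hC, hcap⟩ := exists_toSphere_cap_le n hn
  refine ⟨C * ENNReal.ofReal (2 ^ |α|) * ENNReal.ofReal (α + 1)⁻¹, by finiteness,
    fun a ha t ht => ?_⟩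
  have hT : MeasurableSet {z : Cn n | ‖1 - herm z a‖ < t} :=
    measurableSet_lt (continuous_const.sub (continuous_herm_left _)).norm.measurable measurable_const
  have hB : MeasurableSet (unitBall n) := measurableSet_lt measurable_norm measurable_const
  have hw : Measurable fun z : Cn n => ENNReal.ofReal ((1 - ‖z‖ ^ 2) ^ α) := by fun_prop
  have hwα {r : ℝ} (h0 : 0 < r) (h1 : r < 1) : (1 - r ^ 2) ^ α ≤ 2 ^ |α| * (1 - r) ^ α := by
    rw [show 1 - r ^ 2 = (1 + r) * (1 - r) by ring, Real.mul_rpow (by linarith) (by linarith)]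
    have : (0 : ℝ) ≤ (1 - r) ^ α := Real.rpow_nonneg (by linarith) _
    gcongr
    calc (1 + r) ^ α ≤ (1 + r) ^ |α| := Real.rpow_le_rpow_of_exponent_le (by linarith) (le_abs_self _)
      _ ≤ 2 ^ |α| := by gcongr; linarith
  rw [withDensity_apply _ hT, Measure.restrict_restrict hT, ← lintegral_indicator (hT.inter hB),
    lintegral_eq_polar hn (hw.indicator (hT.inter hB))]
  calc _ ≤ ∫⁻ r in Set.Ioi (0 : ℝ), (Set.Ioo (1 - t) 1).indicator (fun r =>
          C * ENNReal.ofReal (t ^ n) * ENNReal.ofReal (2 ^ |α|) * ENNReal.ofReal ((1 - r) ^ α)) r := by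
        refine setLIntegral_mono' measurableSet_Ioi fun r (hr : 0 < r) => ?_
        -- Since `1 - |z| ≤ |1 - z ā|`, only radii in `(1 - t, 1)` meet the set; each such sphere
        -- meets it in a cap of measure `O(t^n)`.
        by_cases hrt : r ∈ Set.Ioo (1 - t) 1
        · have hra : ‖r • a‖ < 1 := by
            rw [norm_smul, Real.norm_eq_abs, abs_of_pos hr]; nlinarith [hrt.2, norm_nonneg a]
          rw [Set.indicator_of_mem hrt]
          calc _ ≤ 1 * ∫⁻ ζ : Metric.sphere (0 : Cn n) 1,
                {ζ : Metric.sphere (0 : Cn n) 1 | ‖1 - herm (ζ : Cn n) (r • a)‖ < t}.indicator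
                  (fun _ => ENNReal.ofReal (2 ^ |α| * (1 - r) ^ α)) ζ
                  ∂(volume : Measure (Cn n)).toSphere := by
                gcongr with ζ
                · rw [ENNReal.ofReal_le_one]; exact pow_le_one₀ hr.le hrt.2.le
                · by_cases hζ : ‖1 - herm (r • (ζ : Cn n)) a‖ < t
                  · rw [Set.indicator_of_mem (s := {ζ : Metric.sphere (0 : Cn n) 1 | _})]
                    · refine (Set.indicator_le_self _ _ _).trans (ENNReal.ofReal_le_ofReal ?_)
                      rw [norm_smul, norm_eq_of_mem_sphere, Real.norm_eq_abs, abs_of_pos hr, mul_one]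
                      exact hwα hr hrt.2
                    · show ‖1 - herm (ζ : Cn n) (r • a)‖ < t
                      rwa [herm_real_smul_right, ← herm_real_smul_left]
                  · rw [Set.indicator_of_notMem (fun h => hζ h.1)]
                    exact zero_le
            _ ≤ ENNReal.ofReal (2 ^ |α| * (1 - r) ^ α) * (C * ENNReal.ofReal (t ^ n)) := by
                rw [one_mul]
                refine (lintegral_indicator_const_le _ _).trans ?_
                gcongr
                exact hcap _ hra t ht
            _ = _ := by
                rw [ENNReal.ofReal_mul (by positivity)]; ring
        · rw [Set.indicator_of_notMem hrt]
          refine le_of_eq (mul_eq_zero_of_right _ ?_)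
          rw [← lintegral_zero]
          congr 1 with ζ
          apply Set.indicator_of_notMem
          rintro ⟨h1, h2⟩
          have hnz : ‖r • (ζ : Cn n)‖ = r := by
            rw [norm_smul, norm_eq_of_mem_sphere, Real.norm_eq_abs, abs_of_pos hr, mul_one]
          have h3 := one_sub_norm_le_norm_one_sub_herm' (z := r • (ζ : Cn n)) ha.le
          have h1' : ‖1 - herm (r • (ζ : Cn n)) a‖ < t := h1
          have h2' : ‖r • (ζ : Cn n)‖ < 1 := h2
          rw [hnz] at h3 h2'
          exact hrt ⟨by linarith, h2'⟩
    _ ≤ ∫⁻ r, (Set.Ioo (1 - t) 1).indicator (fun r =>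
          C * ENNReal.ofReal (t ^ n) * ENNReal.ofReal (2 ^ |α|) * ENNReal.ofReal ((1 - r) ^ α)) r :=
        setLIntegral_le_lintegral _ _
    _ = C * ENNReal.ofReal (t ^ n) * ENNReal.ofReal (2 ^ |α|) *
          ENNReal.ofReal (t ^ (α + 1) / (α + 1)) := by
        rw [lintegral_indicator measurableSet_Ioo, lintegral_const_mul _ (by fun_prop),
          lintegral_one_sub_rpow hα ht]
    _ = _ := by
        rw [show (n : ℝ) + 1 + α = n + (α + 1) by ring, Real.rpow_add ht (n : ℝ), Real.rpow_natCast,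
          ENNReal.ofReal_mul (by positivity), div_eq_mul_inv, ENNReal.ofReal_mul (by positivity)]
        ring

/-- The Forelli–Rudin estimate on the ball. -/
theorem exists_lintegral_ball_le (n : ℕ) (hn : 1 ≤ n) {α m : ℝ} (hα : -1 < α) (hm : 0 < m) :
    ∃ C : ℝ≥0∞, C ≠ ∞ ∧ ∀ a : Cn n, ‖a‖ < 1 →
      ∫⁻ z, ENNReal.ofReal ((1 - ‖z‖ ^ 2) ^ α * ‖1 - herm z a‖ ^ (-((n : ℝ) + 1 + α + m)))
        ∂(ballMeasure n) ≤ C * ENNReal.ofReal ((1 - ‖a‖ ^ 2) ^ (-m)) := by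
  obtain ⟨C, hC, hvol⟩ := exists_weighted_volume_le n hn hα
  have hBeq : unitBall n = Metric.ball 0 1 := by ext; simp [unitBall]
  have hB : MeasurableSet (unitBall n) := hBeq ▸ measurableSet_ball
  have hV : volume (unitBall n) ≠ 0 := by
    rw [hBeq]; exact (Metric.measure_ball_pos _ _ one_pos).ne'
  refine ⟨(volume (unitBall n))⁻¹ *
    (ENNReal.ofReal (2 ^ ((n : ℝ) + 1 + α) * (1 - 2 ^ (-m))⁻¹) * C * ENNReal.ofReal (2 ^ m)),
    ENNReal.mul_ne_top (ENNReal.inv_ne_top.2 hV) (by finiteness), fun a ha => ?_⟩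
  have hp := half_one_sub_sq_pos ha
  have hg : Measurable fun z : Cn n => ‖1 - herm z a‖ :=
    (continuous_const.sub (continuous_herm_left _)).norm.measurable
  have hw : Measurable fun z : Cn n => ENNReal.ofReal ((1 - ‖z‖ ^ 2) ^ α) := by fun_prop
  have key := lintegral_rpow_neg_le (q := (n : ℝ) + 1 + α) (m := m)
    (by linarith [(Nat.cast_nonneg n : (0 : ℝ) ≤ n)]) hm _ C hg hp
    ((withDensity_absolutelyContinuous _ _).ae_le (by
      filter_upwards [ae_restrict_mem hB] with z hz
      have hz' : ‖z‖ < 1 := hz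
      have := one_sub_norm_le_norm_one_sub_herm (w := a) hz'.le
      linarith [half_one_sub_sq_le (a := a)])) (hvol a ha)
  rw [lintegral_withDensity_eq_lintegral_mul _ hw (by fun_prop)] at key
  rw [ballMeasure, lintegral_smul_measure, smul_eq_mul, mul_assoc]
  gcongr
  calc _ = ∫⁻ z in unitBall n, ENNReal.ofReal ((1 - ‖z‖ ^ 2) ^ α) *
          ENNReal.ofReal (‖1 - herm z a‖ ^ (-((n : ℝ) + 1 + α + m))) := by
        congr 1 with z
        exact ENNReal.ofReal_mul' (by positivity)
    _ ≤ _ := key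
    _ = _ := by
        rw [ofReal_half_rpow_neg (by linarith)]
        ring

/-! ### Inverting a small perturbation of the identity on `ℓ¹`. -/

theorem memlp_one_iff_tsum_enorm {x : ℕ → ℂ} : Memℓp x 1 ↔ ∑' j, ‖x j‖ₑ ≠ ∞ := by
  rw [memℓp_gen_iff (by simp)]
  simp only [ENNReal.toReal_one, Real.rpow_one]
  exact (tsum_enorm_ne_top_iff_summable_norm).symm

/-- Solvability of `x + A x = w` in `ℓ¹` when all columns of `A` have `ℓ¹` norm at most `κ < 1`. -/
theorem exists_hasSum_of_column_le {A : ℕ → ℕ → ℂ} {κ : NNReal} (hκ : κ < 1)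
    (hA : ∀ j, ∑' k, ‖A k j‖ₑ ≤ κ) {w : ℕ → ℂ} (hw : Memℓp w 1) :
    ∃ x : ℕ → ℂ, Memℓp x 1 ∧ ∀ k, HasSum (fun j => A k j * x j) (w k - x k) := by
  have hAle (k j) : ‖A k j‖ₑ ≤ κ := (ENNReal.le_tsum k).trans (hA j)
  -- Tonelli: summing over rows first leaves only the column sums of `A`.
  have hsum (x : ℕ → ℂ) : ∑' k, ∑' j, ‖A k j * x j‖ₑ ≤ κ * ∑' j, ‖x j‖ₑ := by
    rw [ENNReal.tsum_comm, ← ENNReal.tsum_mul_left]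
    gcongr with j
    simp only [enorm_mul]
    rw [ENNReal.tsum_mul_right]
    gcongr
    exact hA j
  have hrow (x : lp (fun _ : ℕ => ℂ) 1) (k : ℕ) : Summable fun j => A k j * x j := by
    have h : ∑' j, ‖A k j * x j‖ₑ ≠ ∞ := by
      refine ne_top_of_le_ne_top ?_ ((ENNReal.le_tsum k).trans (hsum x))
      exact ENNReal.mul_ne_top (by finiteness) (memlp_one_iff_tsum_enorm.1 x.2)
    exact (tsum_enorm_ne_top_iff_summable_norm.1 h).of_norm
  have hbd (x : lp (fun _ : ℕ => ℂ) 1) : ∑' k, ‖∑' j, A k j * x j‖ₑ ≤ κ * ∑' j, ‖x j‖ₑ :=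
    (ENNReal.tsum_le_tsum fun k => enorm_tsum_le_tsum_enorm).trans (hsum x)
  have hnorm (x : lp (fun _ : ℕ => ℂ) 1) : ‖x‖ = (∑' j, ‖x j‖ₑ).toReal := by
    rw [lp.norm_eq_tsum_rpow (by simp), ENNReal.tsum_toReal_eq (by simp)]
    simp
  let R₀ : lp (fun _ : ℕ => ℂ) 1 →ₗ[ℂ] lp (fun _ : ℕ => ℂ) 1 :=
    { toFun x := ⟨fun k => ∑' j, A k j * x j, memlp_one_iff_tsum_enorm.2 <|
        ne_top_of_le_ne_top (ENNReal.mul_ne_top (by finiteness)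
          (memlp_one_iff_tsum_enorm.1 x.2)) (hbd x)⟩
      map_add' x y := by
        ext k
        simp only [lp.coeFn_add, Pi.add_apply, mul_add]
        exact (hrow x k).tsum_add (hrow y k)
      map_smul' c x := by
        ext k
        simp only [lp.coeFn_smul, Pi.smul_apply, smul_eq_mul, RingHom.id_apply, mul_left_comm _ c]
        exact tsum_mul_left }
  have hR₀ (x) : ‖R₀ x‖ ≤ κ * ‖x‖ := by
    rw [hnorm, hnorm, ← ENNReal.coe_toReal, ← ENNReal.toReal_mul]
    exact ENNReal.toReal_mono (ENNReal.mul_ne_top (by finiteness)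
      (memlp_one_iff_tsum_enorm.1 x.2)) (hbd x)
  let R := R₀.mkContinuous κ hR₀
  have hR : ‖-R‖ < 1 := by
    rw [norm_neg]
    exact (R₀.mkContinuous_norm_le κ.2 hR₀).trans_lt hκ
  -- The inverse of `1 - (-R)`, a unit because `‖R‖ ≤ κ < 1`.
  let x : lp (fun _ : ℕ => ℂ) 1 := (Units.oneSub (-R) hR)⁻¹.1 ⟨w, hw⟩
  have hx : x + R x = ⟨w, hw⟩ := by
    have h := congrArg (fun T => T ⟨w, hw⟩) (Units.oneSub (-R) hR).mul_inv
    simpa [sub_neg_eq_add] using h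
  refine ⟨x, x.2, fun k => ?_⟩
  have hk : x k + ∑' j, A k j * x j = w k := congrArg (fun y : lp (fun _ : ℕ => ℂ) 1 => y k) hx
  rw [← hk, add_sub_cancel_left]
  exact (hrow x k).hasSum

/-! ### Kernel series in `B_α^1`. -/

/-- The kernel `(1-|a|²)^c / (1 - z ā)^c`. -/
noncomputable def kern {n : ℕ} (c : ℝ) (a z : Cn n) : ℂ :=
  (((1 - ‖a‖ ^ 2) ^ c : ℝ) : ℂ) * (1 - herm z a) ^ (-(c : ℂ))

theorem one_sub_sq_pos {n : ℕ} {a : Cn n} (ha : ‖a‖ < 1) : 0 < 1 - ‖a‖ ^ 2 := by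
  nlinarith [norm_nonneg a]

/-- The real part is positive, so the principal power in `kern` is holomorphic in `z`. -/
theorem one_sub_herm_mem_slitPlane {n : ℕ} {a z : Cn n} (ha : ‖a‖ < 1) (hz : ‖z‖ ≤ 1) :
    1 - herm z a ∈ Complex.slitPlane := by
  left
  have h1 := norm_herm_le z a
  have h2 := Complex.re_le_norm (herm z a)
  simp only [Complex.sub_re, Complex.one_re]
  nlinarith [norm_nonneg a]

theorem norm_kern {n : ℕ} (c : ℝ) {a : Cn n} (ha : ‖a‖ < 1) (z : Cn n) :
    ‖kern c a z‖ = (1 - ‖a‖ ^ 2) ^ c * ‖1 - herm z a‖ ^ (-c) := by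
  rw [kern, norm_mul, Complex.norm_real, Real.norm_eq_abs,
    abs_of_nonneg (Real.rpow_nonneg (one_sub_sq_pos ha).le _), ← Complex.ofReal_neg,
    Complex.norm_cpow_real]

theorem kern_self {n : ℕ} (c : ℝ) {a : Cn n} (ha : ‖a‖ < 1) : kern c a a = 1 := by
  have h := one_sub_sq_pos ha
  rw [kern, herm_self, ← Complex.ofReal_one, ← Complex.ofReal_sub, ← Complex.ofReal_neg,
    ← Complex.ofReal_cpow h.le, ← Complex.ofReal_mul, ← Real.rpow_add h, add_neg_cancel,
    Real.rpow_zero]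

theorem hasFDerivAt_kern {n : ℕ} (c : ℝ) {a z : Cn n} (ha : ‖a‖ < 1) (hz : ‖z‖ ≤ 1) :
    HasFDerivAt (kern c a) ((((1 - ‖a‖ ^ 2) ^ c : ℝ) : ℂ) •
      ((-(c : ℂ)) * (1 - herm z a) ^ (-(c : ℂ) - 1)) • -(innerSL ℂ a)) z := by
  have h1 : HasFDerivAt (fun z : Cn n => 1 - herm z a) (-(innerSL ℂ a)) z := by
    simp only [herm_eq_inner]
    exact (innerSL ℂ a).hasFDerivAt.const_sub 1
  have h2 := (Complex.hasStrictDerivAt_cpow_const (c := -(c : ℂ))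
    (one_sub_herm_mem_slitPlane ha hz)).hasDerivAt.comp_hasFDerivAt z h1
  exact h2.const_mul _

/-- Apart from `(1 - |a|²)^c` the bound does not depend on the pole, so it dominates the
differentiated series on a ball of radius `r < 1`. -/
theorem norm_fderiv_kern_le {n : ℕ} {c r : ℝ} (hc : 0 ≤ c) (hr : r < 1) {a z : Cn n} (ha : ‖a‖ < 1)
    (hz : ‖z‖ ≤ r) :
    ‖(((1 - ‖a‖ ^ 2) ^ c : ℝ) : ℂ) •
      ((-(c : ℂ)) * (1 - herm z a) ^ (-(c : ℂ) - 1)) • -(innerSL ℂ a)‖ ≤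
      (1 - ‖a‖ ^ 2) ^ c * (c * (1 - r) ^ (-c - 1)) := by
  have h0 : 0 ≤ (1 - ‖a‖ ^ 2) ^ c := Real.rpow_nonneg (one_sub_sq_pos ha).le _
  have h1 := one_sub_norm_le_norm_one_sub_herm' (z := z) ha.le
  rw [norm_smul, norm_smul, norm_neg, innerSL_apply_norm, Complex.norm_real, Real.norm_eq_abs,
    abs_of_nonneg h0, norm_mul, norm_neg, Complex.norm_real, Real.norm_eq_abs, abs_of_nonneg hc,
    show -(c : ℂ) - 1 = ((-c - 1 : ℝ) : ℂ) by push_cast; ring, Complex.norm_cpow_real]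
  have h2 : ‖1 - herm z a‖ ^ (-c - 1) ≤ (1 - r) ^ (-c - 1) :=
    Real.rpow_le_rpow_of_nonpos (by linarith) (by linarith) (by linarith)
  have h3 : 0 ≤ ‖1 - herm z a‖ ^ (-c - 1) := by positivity
  refine mul_le_mul_of_nonneg_left ?_ h0
  calc _ ≤ c * ‖1 - herm z a‖ ^ (-c - 1) * 1 := by gcongr
    _ ≤ _ := by rw [mul_one]; gcongr

/-- Kernel series with coefficients in the weighted `ℓ¹` space are holomorphic on the ball. -/
theorem differentiableOn_tsum_kern {n : ℕ} {c : ℝ} (hc : 0 ≤ c) {a : ℕ → Cn n}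
    (ha : ∀ j, ‖a j‖ < 1) {u : ℕ → ℂ} (hu : Summable fun j => ‖u j‖ * (1 - ‖a j‖ ^ 2) ^ c) :
    DifferentiableOn ℂ (fun z => ∑' j, u j * kern c (a j) z) (unitBall n) := by
  intro z (hz : ‖z‖ < 1)
  obtain ⟨r, hzr, hr⟩ := exists_between hz
  have h := hasFDerivAt_tsum_of_isPreconnected (𝕜 := ℂ) (s := Metric.ball (0 : Cn n) r) (x₀ := 0)
    (x := z) (f := fun j z => u j * kern c (a j) z)
    (hu.mul_right (c * (1 - r) ^ (-c - 1))) Metric.isOpen_ball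
    (convex_ball _ _).isPreconnected
    (fun j y hy => (hasFDerivAt_kern c (ha j)
      ((mem_ball_zero_iff.1 hy).trans hr).le).const_mul (u j))
    (fun j y hy => by
      rw [norm_smul, mul_assoc]
      gcongr
      exact norm_fderiv_kern_le hc hr (ha j) (mem_ball_zero_iff.1 hy).le)
    (Metric.mem_ball_self ((norm_nonneg z).trans_lt hzr))
    -- Convergence at the centre, where `kern c a 0 = (1 - |a|²)^c`.
    (by
      refine Summable.of_norm ?_
      simpa [norm_kern c (ha _), herm] using hu)
    (mem_ball_zero_iff.2 hzr)
  exact h.differentiableAt.differentiableWithinAt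

/-- Term by term integration of kernel series against a measure with a Forelli–Rudin estimate. -/
theorem lintegral_tsum_kern_le {X : Type*} [MeasurableSpace X] {μ : Measure X} {n : ℕ}
    {φ : X → Cn n} (hφ : Measurable φ) {W : X → ℝ≥0∞} (hW : Measurable W) {q m : ℝ}
    {a : ℕ → Cn n} (ha : ∀ j, ‖a j‖ < 1) {C : ℝ≥0∞}
    (hCa : ∀ j, ∫⁻ x, W x * ENNReal.ofReal (‖1 - herm (φ x) (a j)‖ ^ (-(q + m))) ∂μ ≤
      C * ENNReal.ofReal ((1 - ‖a j‖ ^ 2) ^ (-m)))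
    {u : ℕ → ℂ} (hu : Summable fun j => ‖u j‖ * (1 - ‖a j‖ ^ 2) ^ q) :
    ∫⁻ x, W x * ENNReal.ofReal ‖∑' j, u j * kern (q + m) (a j) (φ x)‖ ∂μ ≤
      C * ENNReal.ofReal (∑' j, ‖u j‖ * (1 - ‖a j‖ ^ 2) ^ q) := by
  have hd (j) := one_sub_sq_pos (ha j)
  have hmeas (j) : Measurable fun x =>
      W x * ENNReal.ofReal (‖1 - herm (φ x) (a j)‖ ^ (-(q + m))) := by
    have : Measurable fun x => ‖1 - herm (φ x) (a j)‖ :=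
      (continuous_const.sub (continuous_herm_left (a j))).norm.measurable.comp hφ
    fun_prop
  calc _ ≤ ∫⁻ x, ∑' j, ENNReal.ofReal (‖u j‖ * (1 - ‖a j‖ ^ 2) ^ (q + m)) *
          (W x * ENNReal.ofReal (‖1 - herm (φ x) (a j)‖ ^ (-(q + m)))) ∂μ := by
        gcongr with x
        rw [ofReal_norm]
        refine (mul_le_mul_right enorm_tsum_le_tsum_enorm _).trans (le_of_eq ?_)
        rw [← ENNReal.tsum_mul_left]
        congr 1 with j
        have : (0 : ℝ) ≤ (1 - ‖a j‖ ^ 2) ^ (q + m) := Real.rpow_nonneg (hd j).le _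
        rw [← ofReal_norm, norm_mul, norm_kern _ (ha j), ← mul_assoc,
          ENNReal.ofReal_mul (by positivity), mul_left_comm]
    _ = ∑' j, ENNReal.ofReal (‖u j‖ * (1 - ‖a j‖ ^ 2) ^ (q + m)) *
          ∫⁻ x, W x * ENNReal.ofReal (‖1 - herm (φ x) (a j)‖ ^ (-(q + m))) ∂μ := by
        rw [lintegral_tsum fun j => ((hmeas j).const_mul _).aemeasurable]
        congr 1 with j
        rw [lintegral_const_mul _ (hmeas j)]
    _ ≤ ∑' j, ENNReal.ofReal (‖u j‖ * (1 - ‖a j‖ ^ 2) ^ (q + m)) *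
          (C * ENNReal.ofReal ((1 - ‖a j‖ ^ 2) ^ (-m))) := by
        gcongr with j
        exact hCa j
    _ = C * ENNReal.ofReal (∑' j, ‖u j‖ * (1 - ‖a j‖ ^ 2) ^ q) := by
        have h0 (j) : (0 : ℝ) ≤ (1 - ‖a j‖ ^ 2) ^ q := Real.rpow_nonneg (hd j).le _
        rw [ENNReal.ofReal_tsum_of_nonneg (fun j => mul_nonneg (norm_nonneg _) (h0 j)) hu,
          ← ENNReal.tsum_mul_left]
        congr 1 with j
        have h1 : (0 : ℝ) ≤ (1 - ‖a j‖ ^ 2) ^ (q + m) := Real.rpow_nonneg (hd j).le _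
        rw [mul_left_comm, ← ENNReal.ofReal_mul (by positivity), mul_assoc, ← Real.rpow_add (hd j),
          add_neg_cancel_right]

/-- Kernel series with coefficients in the weighted `ℓ¹` space belong to `B_α^1`. -/
theorem memB_tsum_kern {n : ℕ} (hn : 1 ≤ n) {α m : ℝ} (hα : -1 ≤ α) (hm : 0 < m) {a : ℕ → Cn n}
    (ha : ∀ j, ‖a j‖ < 1) {u : ℕ → ℂ}
    (hu : Summable fun j => ‖u j‖ * (1 - ‖a j‖ ^ 2) ^ ((n : ℝ) + 1 + α)) :
    MemB 1 α fun z => ∑' j, u j * kern ((n : ℝ) + 1 + α + m) (a j) z := by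
  have hn0 : (0 : ℝ) ≤ n := n.cast_nonneg
  refine ⟨differentiableOn_tsum_kern (by linarith) ha (hu.of_nonneg_of_le (fun j => ?_) fun j => ?_),
    fun h => ?_, fun h => ?_⟩
  · exact mul_nonneg (norm_nonneg _) (Real.rpow_nonneg (one_sub_sq_pos (ha j)).le _)
  -- A base in `(0, 1]` decreases when its exponent grows by `m`.
  · gcongr ?_ * ?_
    exact Real.rpow_le_rpow_of_exponent_ge (one_sub_sq_pos (ha j))
      (by nlinarith [norm_nonneg (a j)]) (by linarith)
  · obtain ⟨C, hC, hCa⟩ := exists_lintegral_ball_le n hn (α := α)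
      (lt_of_le_of_ne hα fun h' => h (by rw [← h']; norm_num)) hm
    have key := lintegral_tsum_kern_le (μ := ballMeasure n) measurable_id
      (W := fun z => ENNReal.ofReal ((1 - ‖z‖ ^ 2) ^ α)) (by fun_prop) ha (q := (n : ℝ) + 1 + α)
      (m := m) (fun j => by
        refine le_trans (le_of_eq ?_) (hCa (a j) (ha j))
        congr 1 with z
        rw [ENNReal.ofReal_mul' (by positivity), id]) hu
    refine lt_of_le_of_lt (le_of_eq ?_) (key.trans_lt (by finiteness))
    rw [weightedInt]
    congr 1 with z
    rw [mul_one, Real.rpow_one, ENNReal.ofReal_mul' (norm_nonneg _), id]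
  -- Hardy endpoint: here `q = n`, matching the cap exponent.
  · obtain rfl : α = -1 := by rw [h]; norm_num
    obtain ⟨C, hC, hCa⟩ := exists_lintegral_sphere_le n hn hm
    have hq : (n : ℝ) + 1 + -1 = n := by ring
    rw [hq] at hu ⊢
    refine lt_of_le_of_lt (b := C * ENNReal.ofReal (∑' j, ‖u j‖ * (1 - ‖a j‖ ^ 2) ^ (n : ℝ)))
      (iSup₂_le fun r hr => ?_) (by finiteness)
    have key := lintegral_tsum_kern_le (μ := sphereMeasure n)
      (φ := fun ζ : Metric.sphere (0 : Cn n) 1 => (r : ℂ) • (ζ : Cn n)) (by fun_prop) (W := 1)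
      measurable_one ha (fun j => by
        simpa only [Pi.one_apply, one_mul] using hCa (a j) (ha j) r hr) hu
    simpa only [Pi.one_apply, one_mul, Real.rpow_one] using key

/-! ### The interpolation problem as a linear system. -/

/-- A sequence with `K({a_k}, m, n+1+α) < 1` is interpolating for `B_α^1`. -/
theorem isInterpolating_of_K_lt_one {n : ℕ} (hn : 1 ≤ n) {α m : ℝ} (hα : -1 ≤ α) (hm : 0 < m)
    {a : ℕ → Cn n} (ha : ∀ k, a k ∈ unitBall n) (hK : K a m ((n : ℝ) + 1 + α) < 1) :
    IsInterpolating 1 α a := by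
  intro v hv
  have ha' (k) : ‖a k‖ < 1 := ha k
  have hd (k) : 0 < 1 - ‖a k‖ ^ 2 := one_sub_sq_pos (ha' k)
  set q : ℝ := (n : ℝ) + 1 + α with hq
  have hw : Memℓp (fun k => (((1 - ‖a k‖ ^ 2) ^ q : ℝ) : ℂ) * v k) 1 := by
    simpa only [MemSeq, ENNReal.ofReal_one, div_one] using hv
  have hdq (k) : (0 : ℝ) < (1 - ‖a k‖ ^ 2) ^ q := Real.rpow_pos_of_pos (hd k) _
  -- The kernel matrix without its diagonal, conjugated by the weights `d^q`. In column `j`,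
  -- `d_j^{q+m} d_j^{-q} = d_j^m`, which gives the summand of `K` with the pole `a_j` as the index
  -- of the supremum.
  let A : ℕ → ℕ → ℂ := fun k j => if k = j then 0 else
    (((1 - ‖a k‖ ^ 2) ^ q * ((1 - ‖a j‖ ^ 2) ^ q)⁻¹ : ℝ) : ℂ) * kern (q + m) (a j) (a k)
  have hA (j) : ∑' k, ‖A k j‖ₑ ≤ ((K a m q).toNNReal : ℝ≥0∞) := by
    rw [ENNReal.coe_toNNReal hK.ne_top]
    refine le_trans (le_of_eq ?_) (le_iSup _ j)
    refine Eq.trans ?_ (tsum_subtype {k | k ≠ j} fun k => ENNReal.ofReal ((1 - ‖a j‖ ^ 2) ^ m *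
      (1 - ‖a k‖ ^ 2) ^ q / ‖1 - herm (a k) (a j)‖ ^ (m + q))).symm
    congr 1 with k
    by_cases hkj : k = j
    · simp [A, hkj]
    · rw [Set.indicator_of_mem (by exact hkj)]
      simp only [A, if_neg hkj]
      have h1 : 0 ≤ (1 - ‖a k‖ ^ 2) ^ q * ((1 - ‖a j‖ ^ 2) ^ q)⁻¹ :=
        (mul_pos (hdq k) (inv_pos.2 (hdq j))).le
      rw [← ofReal_norm, norm_mul, norm_kern _ (ha' j), Complex.norm_real, Real.norm_eq_abs,
        abs_of_nonneg h1, Real.rpow_add (hd j) q m, Real.rpow_neg (norm_nonneg _), add_comm q m]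
      congr 1
      have h2 := (hdq j).ne'
      generalize (1 - ‖a j‖ ^ 2) ^ q = D at h2 ⊢
      field_simp
  obtain ⟨x, hx, hsol⟩ := exists_hasSum_of_column_le (by
    rw [← ENNReal.coe_lt_coe, ENNReal.coe_toNNReal hK.ne_top]; exact hK) hA hw
  let u : ℕ → ℂ := fun j => x j * (((1 - ‖a j‖ ^ 2) ^ q : ℝ) : ℂ)⁻¹
  have hu : Summable fun j => ‖u j‖ * (1 - ‖a j‖ ^ 2) ^ q := by
    refine ((memℓp_gen_iff (by simp)).1 hx).congr fun j => ?_
    simp only [u, norm_mul, norm_inv, Complex.norm_real, Real.norm_eq_abs, abs_of_pos (hdq j),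
      inv_mul_cancel_right₀ (hdq j).ne', ENNReal.toReal_one, Real.rpow_one]
  refine ⟨_, memB_tsum_kern hn hα hm ha' hu, fun k => ?_⟩
  have hne (j) : (((1 - ‖a j‖ ^ 2) ^ q : ℝ) : ℂ) ≠ 0 := Complex.ofReal_ne_zero.2 (hdq j).ne'
  -- Adding `x k` at index `k` restores the diagonal term, where the kernel equals `1`.
  have hfin := ((hsol k).add (hasSum_ite_eq k (x k))).mul_left (((1 - ‖a k‖ ^ 2) ^ q : ℝ) : ℂ)⁻¹
  rw [sub_add_cancel, inv_mul_cancel_left₀ (hne k)] at hfin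
  refine (hfin.congr_fun fun j => ?_).tsum_eq
  by_cases hkj : j = k
  · subst hkj
    simp [A, u, kern_self _ (ha' j), mul_comm, ← hq]
  · simp only [A, u, if_neg hkj, if_neg (Ne.symm hkj), add_zero, Complex.ofReal_mul,
      Complex.ofReal_inv]
    field_simp [hne k, hne j]
    rw [hq]

end BallInterp

theorem theorem4p2 (n : ℕ) (hn : 1 ≤ n) (α : ℝ) (hα : -1 ≤ α)
    (a : ℕ → BallInterp.Cn n) (ha : ∀ k, a k ∈ BallInterp.unitBall n)
    (hsep : BallInterp.IsSeparated a)
    (hK : ∃ m : ℝ, 0 < m ∧ BallInterp.K a m ((n : ℝ) + 1 + α) < 1) :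
    BallInterp.IsInterpolating 1 α a := by
  obtain ⟨m, hm, hK⟩ := hK
  exact BallInterp.isInterpolating_of_K_lt_one hn hα hm ha hK
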